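/- Consider the binary propositional connective $\rightharpoonup$ for which, under every valuation, $\phi\rightharpoonup\psi$ is false exactly when both $\phi$ and $\psi$ are true. For $n\ge 1$ let $p_1,\dots,p_n$ be distinct propositional variables, and let $y_n$ be the total number of rows with the value "false" in the truth tables (with $2^n$ rows each, one for each valuation of $p_1,\dots,p_n$) of all the formulae obtained from $$p_1\rightharpoonup p_2\rightharpoonup\cdots\rightharpoonup p_n$$ by inserting brackets so that the result is well formed; the rows are counted separately for each such formula. Then, as $n\to\infty$, $$y_n\sim\left(\frac{10-2\sqrt{10}}{10}\right)\frac{2^{3n-2}}{\sqrt{\pi n^3}},$$ that is, the ratio of the two sides tends to $1$. -/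

import Mathlib

open Filter Asymptotics

/-- Propositional formulae over the variables `α`, built with the single binary connective `⇀`. -/
inductive MFormula (α : Type*) where
  | var (a : α) : MFormula α
  | mimp (φ ψ : MFormula α) : MFormula α

namespace MFormula

/-- The truth value of a formula under a valuation of the variables:
`φ ⇀ ψ` is false exactly when both `φ` and `ψ` are true. -/
def eval {α : Type*} (ν : α → Bool) : MFormula α → Bool
  | var a => ν a
  | mimp φ ψ => !(eval ν φ && eval ν ψ)

/-- The list of variables of a formula, read from left to right. -/
def leaves {α : Type*} : MFormula α → List α
  | var a => [a]
  | mimp φ ψ => leaves φ ++ leaves ψ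

theorem leaves_length_pos {α : Type*} (φ : MFormula α) : 0 < φ.leaves.length := by
  induction φ with
  | var a => simp [leaves]
  | mimp φ ψ h₁ h₂ => simp only [leaves, List.length_append]; omega

/-- The chain `l₁ ⇀ l₂ ⇀ ⋯ ⇀ lₘ` has only finitely many bracketings. -/
theorem finite_setOf_leaves_eq {α : Type*} (l : List α) :
    {φ : MFormula α | φ.leaves = l}.Finite := by
  suffices H : ∀ N : ℕ, ∀ l : List α, l.length ≤ N → {φ : MFormula α | φ.leaves = l}.Finite from
    H _ l le_rfl
  intro N
  induction N with
  | zero =>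
    intro l hl
    refine Set.Finite.subset Set.finite_empty ?_
    intro φ hφ
    have h := φ.leaves_length_pos
    rw [Set.mem_setOf_eq] at hφ
    rw [hφ] at h
    omega
  | succ N ih =>
    intro l hl
    have hA : (⋃ a ∈ {a | a ∈ l}, {var a} : Set (MFormula α)).Finite :=
      Set.Finite.biUnion (List.finite_toSet l) fun a _ => Set.finite_singleton _
    have hB : (⋃ k ∈ {k | k < l.length ∧ 0 < k},
        Set.image2 mimp {φ : MFormula α | φ.leaves = l.take k}
          {φ : MFormula α | φ.leaves = l.drop k}).Finite := by
      refine Set.Finite.biUnion ((Set.finite_lt_nat l.length).subset fun k hk => hk.1) ?_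
      rintro k ⟨hk, hk'⟩
      refine Set.Finite.image2 _ (ih _ ?_) (ih _ ?_)
      · rw [List.length_take]; omega
      · rw [List.length_drop]; omega
    refine (hA.union hB).subset ?_
    intro φ hφ
    rw [Set.mem_setOf_eq] at hφ
    cases φ with
    | var a =>
      left
      subst hφ
      simp [leaves]
    | mimp φ ψ =>
      right
      have h₁ := φ.leaves_length_pos
      have h₂ := ψ.leaves_length_pos
      subst hφ
      simp only [leaves, Set.mem_iUnion]
      refine ⟨φ.leaves.length, ⟨?_, h₁⟩, φ, ?_, ψ, ?_, rfl⟩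
      · rw [List.length_append]; omega
      · simp
      · simp

/-- The bracketings of `p₁ ⇀ p₂ ⇀ ⋯ ⇀ pₙ`: all the formulae whose variables, read from left to
right, are the distinct propositions `p₁, …, pₙ`, each occurring once. -/
noncomputable def bracketings (n : ℕ) : Finset (MFormula (Fin n)) :=
  (finite_setOf_leaves_eq (List.finRange n)).toFinset

/-- The number of rows with the value "false" in the truth table of a formula in the variables
`p₁, …, pₙ`; the rows are the `2 ^ n` valuations. -/
def falseRows {n : ℕ} (φ : MFormula (Fin n)) : ℕ :=
  (Finset.univ.filter fun ν : Fin n → Bool => φ.eval ν = false).card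

/-- The total number `yₙ` of rows with the value "false" in the truth tables of all the
bracketings of `p₁ ⇀ p₂ ⇀ ⋯ ⇀ pₙ`. -/
noncomputable def totalFalseRows (n : ℕ) : ℕ :=
  ∑ φ ∈ bracketings n, falseRows φ

end MFormula

/-! Let F, T and G be the generating functions of the false rows, the true rows and all rows. A
bracketing is a binary tree, and splitting it at the root gives F = X + T², G = F + T and G = 2X +
G² (the Catalan recurrence). Eliminating T and X leaves (1 + 2G - 2F)² = 1 + 2G + 2G², so 1 + 2G -
2F = f(G) with f(u) = √(1 + 2u + 2u²). The coefficients of Gᵏ⁺¹ are explicit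
(`coeff_rowSeries_pow`). Divided by those of G, they tend to (k + 1)/2ᵏ and never exceed it
(`tendsto_ratio`, `ratio_le`). As f is analytic on a disc containing 1/2, dominated convergence
gives [xⁿ] f(G) / [xⁿ] G → f'(1/2) = 4/√10 (`tendsto_coeff_subst_rowSeries`), hence [xⁿ] F / [xⁿ] G
→ 1 - 2/√10. Wallis' product yields the asymptotics of [xⁿ] G = 2ⁿ · `catalan (n - 1)`. -/

namespace MFormula

/-! ### Bracketings as binary trees -/

open BinaryTree

/-- The binary tree underlying a formula. -/
def shape {α : Type*} : MFormula α → BinaryTree Unit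
  | var _ => nil
  | mimp φ ψ => node () φ.shape ψ.shape

theorem length_leaves {α : Type*} (φ : MFormula α) :
    φ.leaves.length = φ.shape.numNodes + 1 := by
  induction φ with
  | var a => simp [leaves, shape]
  | mimp φ ψ h₁ h₂ => simp only [leaves, shape, List.length_append, numNodes, h₁, h₂]; omega

theorem eq_of_shape_eq_of_leaves_eq {α : Type*} {φ ψ : MFormula α} (hs : φ.shape = ψ.shape)
    (hl : φ.leaves = ψ.leaves) : φ = ψ := by
  induction φ generalizing ψ with
  | var a =>
    cases ψ with
    | var b => simpa [leaves] using hl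
    | mimp ψ₁ ψ₂ => simp [shape] at hs
  | mimp φ₁ φ₂ h₁ h₂ =>
    cases ψ with
    | var b => simp [shape] at hs
    | mimp ψ₁ ψ₂ =>
      simp only [shape, node.injEq, true_and] at hs
      have h := List.append_inj hl (by simp [length_leaves, hs.1])
      rw [h₁ hs.1 h.1, h₂ hs.2 h.2]

theorem exists_shape_eq_leaves_eq {α : Type*} (t : BinaryTree Unit) (l : List α)
    (h : l.length = t.numNodes + 1) : ∃ φ : MFormula α, φ.shape = t ∧ φ.leaves = l := by
  induction t generalizing l with
  | nil =>
    obtain ⟨a, rfl⟩ := List.length_eq_one_iff.mp (by simpa using h)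
    exact ⟨var a, rfl, rfl⟩
  | node u t₁ t₂ h₁ h₂ =>
    simp only [numNodes] at h
    obtain ⟨φ, hφ, hφl⟩ := h₁ (l.take (t₁.numNodes + 1)) (by rw [List.length_take]; omega)
    obtain ⟨ψ, hψ, hψl⟩ := h₂ (l.drop (t₁.numNodes + 1)) (by rw [List.length_drop]; omega)
    refine ⟨mimp φ ψ, ?_, ?_⟩
    · simp [shape, hφ, hψ]
    · simp [leaves, hφl, hψl]

/-! ### Truth-table rows counted by shape -/

/-- The truth value of a formula when its leaves receive, from left to right, the given values. -/
def evalList {α : Type*} : MFormula α → List Bool → Bool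
  | var _, l => l.headD false
  | mimp φ ψ, l =>
    !(evalList φ (l.take φ.leaves.length) && evalList ψ (l.drop φ.leaves.length))

/-- A proper subformula of a bracketing uses only some of the variables in `Fin n`, so the induction
on formulae assigns values to leaf positions instead. -/
theorem evalList_map_leaves {α : Type*} (ν : α → Bool) (φ : MFormula α) :
    φ.evalList (φ.leaves.map ν) = φ.eval ν := by
  induction φ with
  | var a => simp [leaves, evalList, eval]
  | mimp φ ψ h₁ h₂ =>
    have e : φ.leaves.length = (φ.leaves.map ν).length := by simp
    simp only [evalList, leaves, eval, List.map_append]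
    rw [e, List.take_left, List.drop_left, h₁, h₂]

/-- The number of `false` and of `true` rows in the truth table of a formula with distinct
variables and with the given shape. -/
def rowCounts : BinaryTree Unit → ℕ × ℕ
  | nil => (1, 1)
  | node _ s t =>
    ((rowCounts s).2 * (rowCounts t).2,
      (rowCounts s).1 * (rowCounts t).1 + (rowCounts s).1 * (rowCounts t).2 +
        (rowCounts s).2 * (rowCounts t).1)

theorem rowCounts_add (t : BinaryTree Unit) :
    (rowCounts t).1 + (rowCounts t).2 = 2 ^ (t.numNodes + 1) := by
  induction t with
  | nil => simp [rowCounts]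
  | node u s t h₁ h₂ =>
    have : (2 : ℕ) ^ (s.numNodes + t.numNodes + 1 + 1) =
        2 ^ (s.numNodes + 1) * 2 ^ (t.numNodes + 1) := by
      rw [← pow_add]; congr 1; omega
    simp only [rowCounts, numNodes]
    rw [this, ← h₁, ← h₂]
    ring

theorem card_filter_append (a b : ℕ) (p q : List Bool → Prop) [DecidablePred p]
    [DecidablePred q] :
    (Finset.univ.filter fun ν : Fin (a + b) → Bool =>
      p ((List.ofFn ν).take a) ∧ q ((List.ofFn ν).drop a)).card =
    (Finset.univ.filter fun ν : Fin a → Bool => p (List.ofFn ν)).card *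
      (Finset.univ.filter fun ν : Fin b → Bool => q (List.ofFn ν)).card := by
  rw [← Finset.card_product]
  symm
  refine Finset.card_equiv (Fin.appendEquiv a b) ?_
  rintro ⟨u, v⟩
  have ht : (List.ofFn u ++ List.ofFn v).take a = List.ofFn u :=
    List.take_left' List.length_ofFn
  have hd : (List.ofFn u ++ List.ofFn v).drop a = List.ofFn v :=
    List.drop_left' List.length_ofFn
  simp [Fin.appendEquiv, List.ofFn_fin_append, ht, hd]

theorem card_evalList {α : Type*} (φ : MFormula α) (n : ℕ) (hn : φ.leaves.length = n) :
    (Finset.univ.filter fun ν : Fin n → Bool => φ.evalList (List.ofFn ν) = false).card =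
        (rowCounts φ.shape).1 ∧
      (Finset.univ.filter fun ν : Fin n → Bool => φ.evalList (List.ofFn ν) = true).card =
        (rowCounts φ.shape).2 := by
  have key : (Finset.univ.filter fun ν : Fin n → Bool => φ.evalList (List.ofFn ν) = false).card +
      (Finset.univ.filter fun ν : Fin n → Bool => φ.evalList (List.ofFn ν) = true).card =
      (rowCounts φ.shape).1 + (rowCounts φ.shape).2 := by
    rw [rowCounts_add, ← length_leaves, hn]
    have h := Finset.card_filter_add_card_filter_not (s := (Finset.univ : Finset (Fin n → Bool)))
      (fun ν => φ.evalList (List.ofFn ν) = false)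
    simpa using h
  -- Both pairs of counts sum to 2ⁿ, so the `false` count determines the other.
  suffices h : (Finset.univ.filter fun ν : Fin n → Bool =>
      φ.evalList (List.ofFn ν) = false).card = (rowCounts φ.shape).1 from ⟨h, by omega⟩
  clear key
  induction φ generalizing n with
  | var a =>
    simp only [leaves, List.length_singleton] at hn
    subst hn
    have h : (Finset.univ.filter fun ν : Fin 1 → Bool =>
        (List.ofFn ν).headD false = false).card = 1 := by decide
    exact h
  | mimp φ ψ h₁ h₂ =>
    simp only [leaves, List.length_append] at hn
    subst hn
    have compl : ∀ χ : MFormula α, (Finset.univ.filter fun ν : Fin χ.leaves.length → Bool =>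
        χ.evalList (List.ofFn ν) = false).card = (rowCounts χ.shape).1 →
        (Finset.univ.filter fun ν : Fin χ.leaves.length → Bool =>
        χ.evalList (List.ofFn ν) = true).card = (rowCounts χ.shape).2 := by
      intro χ hχ
      have h := Finset.card_filter_add_card_filter_not
        (s := (Finset.univ : Finset (Fin χ.leaves.length → Bool)))
        (fun ν => χ.evalList (List.ofFn ν) = false)
      have h' := rowCounts_add χ.shape
      rw [← length_leaves] at h'
      simp only [Bool.not_eq_false, Finset.card_univ, Fintype.card_pi, Fintype.card_bool,
        Finset.prod_const, Fintype.card_fin] at h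
      omega
    have := card_filter_append φ.leaves.length ψ.leaves.length
      (fun l => φ.evalList l = true) (fun l => ψ.evalList l = true)
    simp only [evalList, shape, rowCounts, Bool.not_eq_false', Bool.and_eq_true]
    rw [this, compl φ (h₁ _ rfl), compl ψ (h₂ _ rfl)]

theorem falseRows_eq_rowCounts {n : ℕ} {φ : MFormula (Fin n)} (h : φ.leaves = List.finRange n) :
    falseRows φ = (rowCounts φ.shape).1 := by
  rw [← (card_evalList φ n (by simp [h])).1, falseRows]
  congr 1
  ext ν
  simp only [Finset.mem_filter, Finset.mem_univ, true_and]
  rw [← evalList_map_leaves ν φ, h, List.ofFn_eq_map]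

theorem totalFalseRows_succ_eq_sum (m : ℕ) :
    totalFalseRows (m + 1) = ∑ t ∈ treesOfNumNodesEq m, (rowCounts t).1 := by
  have hb : ∀ φ : MFormula (Fin (m + 1)), φ ∈ bracketings (m + 1) ↔
      φ.leaves = List.finRange (m + 1) := by
    intro φ
    simp [bracketings]
  unfold totalFalseRows
  refine Finset.sum_bij (fun φ _ => φ.shape) ?_ ?_ ?_ ?_
  · intro φ hφ
    have h := length_leaves φ
    rw [(hb φ).mp hφ, List.length_finRange] at h
    rw [mem_treesOfNumNodesEq]
    omega
  · intro φ hφ ψ hψ h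
    exact eq_of_shape_eq_of_leaves_eq h (((hb φ).mp hφ).trans ((hb ψ).mp hψ).symm)
  · intro t ht
    rw [mem_treesOfNumNodesEq] at ht
    obtain ⟨φ, h, h'⟩ := exists_shape_eq_leaves_eq t (List.finRange (m + 1)) (by simp [ht])
    exact ⟨φ, (hb φ).mpr h', h⟩
  · intro φ hφ
    exact falseRows_eq_rowCounts ((hb φ).mp hφ)

/-! ### Generating functions and their algebraic equations -/

theorem sum_treesOfNumNodesEq_succ {M : Type*} [AddCommMonoid M] (m : ℕ)
    (f : BinaryTree Unit → M) :
    ∑ t ∈ treesOfNumNodesEq (m + 1), f t = ∑ ij ∈ Finset.HasAntidiagonal.antidiagonal m,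
      ∑ s ∈ treesOfNumNodesEq ij.1, ∑ t ∈ treesOfNumNodesEq ij.2, f (node () s t) := by
  rw [treesOfNumNodesEq_succ, Finset.sum_biUnion]
  · refine Finset.sum_congr rfl fun ij _ => ?_
    rw [Finset.sum_map, Finset.sum_product]
    rfl
  · simp_rw [Set.PairwiseDisjoint, Set.Pairwise, Finset.disjoint_left]
    aesop

open PowerSeries in
/-- The generating function of the total numbers of `false` rows. -/
noncomputable def falseSeries : PowerSeries ℂ :=
  X * PowerSeries.mk fun m => ((∑ t ∈ treesOfNumNodesEq m, (rowCounts t).1 : ℕ) : ℂ)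

open PowerSeries in
/-- The generating function of the total numbers of `true` rows. -/
noncomputable def trueSeries : PowerSeries ℂ :=
  X * PowerSeries.mk fun m => ((∑ t ∈ treesOfNumNodesEq m, (rowCounts t).2 : ℕ) : ℂ)

open PowerSeries in
/-- The generating function of the total numbers of rows. -/
noncomputable def rowSeries : PowerSeries ℂ :=
  X * PowerSeries.mk fun m => ((2 ^ (m + 1) * catalan m : ℕ) : ℂ)

theorem coeff_succ_falseSeries (m : ℕ) :
    PowerSeries.coeff (m + 1) falseSeries = (totalFalseRows (m + 1) : ℂ) := by
  rw [falseSeries, PowerSeries.coeff_succ_X_mul, PowerSeries.coeff_mk, totalFalseRows_succ_eq_sum]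

theorem coeff_succ_rowSeries (m : ℕ) :
    PowerSeries.coeff (m + 1) rowSeries = 2 ^ (m + 1) * (catalan m : ℂ) := by
  rw [rowSeries, PowerSeries.coeff_succ_X_mul, PowerSeries.coeff_mk]
  push_cast
  rfl

theorem constantCoeff_rowSeries : PowerSeries.constantCoeff rowSeries = 0 := by
  simp [rowSeries]

theorem constantCoeff_falseSeries : PowerSeries.constantCoeff falseSeries = 0 := by
  simp [falseSeries]

theorem falseSeries_add_trueSeries : falseSeries + trueSeries = rowSeries := by
  rw [falseSeries, trueSeries, rowSeries, ← mul_add]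
  congr 1
  ext m
  simp only [map_add, PowerSeries.coeff_mk]
  norm_cast
  rw [← Finset.sum_add_distrib, Finset.sum_congr rfl fun t ht => by
    rw [rowCounts_add, mem_treesOfNumNodesEq.mp ht]]
  rw [Finset.sum_const, treesOfNumNodesEq_card_eq_catalan, smul_eq_mul, mul_comm]

theorem falseSeries_eq : falseSeries = PowerSeries.X + trueSeries ^ 2 := by
  have : (PowerSeries.mk fun m => ((∑ t ∈ treesOfNumNodesEq m, (rowCounts t).1 : ℕ) : ℂ)) =
      1 + PowerSeries.X *
        (PowerSeries.mk fun m => ((∑ t ∈ treesOfNumNodesEq m, (rowCounts t).2 : ℕ) : ℂ)) ^ 2 := by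
    ext m
    cases m with
    | zero => simp [rowCounts]
    | succ m =>
      rw [map_add, PowerSeries.coeff_succ_X_mul, pow_two, PowerSeries.coeff_mul]
      simp only [PowerSeries.coeff_mk, PowerSeries.coeff_one, Nat.succ_ne_zero, if_false, zero_add,
        sum_treesOfNumNodesEq_succ, rowCounts]
      push_cast
      simp_rw [Finset.sum_mul_sum]
  rw [falseSeries, trueSeries, this]
  ring

theorem rowSeries_eq : rowSeries = 2 * PowerSeries.X + rowSeries ^ 2 := by
  have : (PowerSeries.mk fun m => ((2 ^ (m + 1) * catalan m : ℕ) : ℂ)) =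
      2 + PowerSeries.X * (PowerSeries.mk fun m => ((2 ^ (m + 1) * catalan m : ℕ) : ℂ)) ^ 2 := by
    ext m
    rw [show (2 : PowerSeries ℂ) = PowerSeries.C 2 from rfl]
    cases m with
    | zero => simp
    | succ m =>
      rw [map_add, PowerSeries.coeff_succ_X_mul, pow_two, PowerSeries.coeff_mul]
      simp only [PowerSeries.coeff_mk, PowerSeries.coeff_C, Nat.succ_ne_zero, if_false, zero_add]
      norm_cast
      rw [catalan_succ', Finset.mul_sum]
      refine Finset.sum_congr rfl fun ij hij => ?_
      rw [← Finset.HasAntidiagonal.mem_antidiagonal.mp hij]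
      ring
  rw [rowSeries]
  nth_rw 1 [this]
  ring

/-- Substituting T = G - F and 2X = G - G² into F = X + T² and completing the square leaves no
explicit X. -/
theorem sq_one_add_two_mul_rowSeries_sub :
    (1 + 2 * rowSeries - 2 * falseSeries) ^ 2 = 1 + 2 * rowSeries + 2 * rowSeries ^ 2 := by
  have h₁ := falseSeries_eq
  have h₂ := rowSeries_eq
  rw [← sub_eq_iff_eq_add'.mpr falseSeries_add_trueSeries.symm] at h₁
  linear_combination (-4) * h₁ + 2 * h₂

/-! ### Coefficients of the powers of `rowSeries` -/

open scoped Nat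

theorem coeff_rowSeries_pow_eq_zero {k n : ℕ} (h : n < k) :
    PowerSeries.coeff n (rowSeries ^ k) = 0 :=
  PowerSeries.coeff_of_lt_order _ <| lt_of_lt_of_le (by exact_mod_cast h)
    (PowerSeries.le_order_pow_of_constantCoeff_eq_zero k constantCoeff_rowSeries)

/-- This is G² = G - 2X multiplied by Gᵏ; `ballot_add_two` is the matching recurrence for the closed
form. -/
theorem coeff_rowSeries_pow_add_two (k n : ℕ) :
    PowerSeries.coeff (n + 1) (rowSeries ^ (k + 2)) =
      PowerSeries.coeff (n + 1) (rowSeries ^ (k + 1)) -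
        2 * PowerSeries.coeff n (rowSeries ^ k) := by
  have h : rowSeries ^ (k + 2) =
      rowSeries ^ (k + 1) - PowerSeries.X * (PowerSeries.C 2 * rowSeries ^ k) := by
    have h₂ := rowSeries_eq
    rw [show (PowerSeries.C (2 : ℂ)) = 2 from rfl]
    linear_combination -rowSeries ^ k * h₂
  rw [h, map_sub, PowerSeries.coeff_succ_X_mul, PowerSeries.coeff_C_mul]

theorem centralBinom_mul_factorial_mul_factorial (m : ℕ) :
    (Nat.centralBinom m : ℝ) * (m ! * m !) = (2 * m)! := by
  have := Nat.choose_mul_factorial_mul_factorial (show m ≤ 2 * m by omega)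
  rw [show 2 * m - m = m by omega] at this
  rw [Nat.centralBinom_eq_two_mul_choose, ← mul_assoc]
  exact_mod_cast this

theorem catalan_eq_factorial_div (m : ℕ) :
    (catalan m : ℝ) = (2 * m)! / (m ! * (m + 1)!) := by
  have h : ((m + 1 : ℕ) : ℝ) * catalan m = Nat.centralBinom m := by
    exact_mod_cast succ_mul_catalan_eq_centralBinom m
  have h' := centralBinom_mul_factorial_mul_factorial m
  rw [eq_div_iff (by positivity), ← h', ← h, Nat.factorial_succ]
  push_cast
  ring

/-- The coefficient of `x ^ (k + 1 + m)` in the power `k + 1` of `MFormula.rowSeries`. -/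
noncomputable def ballot (k m : ℕ) : ℝ :=
  2 ^ (k + 1 + m) * ((k + 1) * (2 * m + k)! / (m ! * (m + k + 1)!))

theorem ballot_pos (k m : ℕ) : 0 < ballot k m := by
  unfold ballot; positivity

theorem ballot_zero (m : ℕ) : ballot 0 m = 2 ^ (m + 1) * catalan m := by
  rw [ballot, catalan_eq_factorial_div]
  simp [add_comm]

theorem ballot_succ (k m : ℕ) :
    ballot (k + 1) m =
      ((k + 2) * (m + 1) / ((k + 1) * (2 * m + k + 2))) * ballot k (m + 1) := by
  unfold ballot
  rw [show 2 * (m + 1) + k = 2 * m + (k + 1) + 1 by ring,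
    show m + 1 + k + 1 = m + k + 1 + 1 by ring,
    show m + (k + 1) + 1 = m + k + 1 + 1 by ring, Nat.factorial_succ (2 * m + (k + 1)),
    Nat.factorial_succ m, show k + 1 + (m + 1) = k + 1 + 1 + m by ring]
  push_cast
  have : (2 * m + (k + 1) + 1 : ℝ) ≠ 0 := by positivity
  field_simp
  ring

theorem ballot_add_two (k m : ℕ) :
    ballot (k + 2) m = ballot (k + 1) (m + 1) - 2 * ballot k (m + 1) := by
  rw [ballot_succ (k + 1) m, ballot_succ k (m + 1)]
  have e : ballot k (m + 2) = 2 * ((2 * m + k + 4) * (2 * m + k + 3) / ((m + 2) * (m + k + 3))) *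
      ballot k (m + 1) := by
    unfold ballot
    rw [show 2 * (m + 2) + k = 2 * (m + 1) + k + 1 + 1 by ring,
      show m + 2 + k + 1 = m + 1 + k + 1 + 1 by ring, Nat.factorial_succ (2 * (m + 1) + k + 1),
      Nat.factorial_succ (2 * (m + 1) + k), Nat.factorial_succ (m + 1 + k + 1),
      Nat.factorial_succ (m + 1), show k + 1 + (m + 2) = k + 1 + (m + 1) + 1 by ring, pow_succ]
    push_cast
    field_simp
    ring
  rw [e]
  push_cast
  field_simp
  ring

theorem coeff_rowSeries_pow (k m : ℕ) :
    PowerSeries.coeff (k + 1 + m) (rowSeries ^ (k + 1)) = (ballot k m : ℂ) := by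
  induction k using Nat.twoStepInduction generalizing m with
  | zero =>
    rw [ballot_zero, zero_add, pow_one, add_comm 1 m, coeff_succ_rowSeries]
    push_cast
    rfl
  | one =>
    have h := coeff_rowSeries_pow_add_two 0 (m + 1)
    rw [pow_zero, PowerSeries.coeff_one, if_neg (by omega), pow_one, coeff_succ_rowSeries] at h
    rw [show 1 + 1 + m = m + 1 + 1 by ring]
    refine h.trans ?_
    rw [ballot_succ 0 m, ballot_zero]
    push_cast
    have : (m + 1 : ℂ) ≠ 0 := by exact_mod_cast (by omega : m + 1 ≠ 0)
    have e : (0 + 2) * (m + 1) / ((0 + 1) * (2 * m + 0 + 2)) = (1 : ℂ) := by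
      rw [show (0 + 1) * (2 * m + 0 + 2) = 2 * (m + 1 : ℂ) by ring]
      field_simp
      norm_num
    rw [e]
    ring
  | more k h₀ h₁ =>
    rw [ballot_add_two, show k + 2 + 1 + m = (k + 1 + (m + 1)) + 1 by ring,
      show k + 2 + 1 = k + 1 + 2 by ring, coeff_rowSeries_pow_add_two, h₀,
      show k + 1 + (m + 1) + 1 = k + 1 + 1 + (m + 1) by ring, h₁]
    push_cast
    rfl

/-! ### Limits and uniform bounds for coefficient ratios -/

/-- The ratio of the coefficients of `x ^ n` in the powers `k + 1` and `1` of
`MFormula.rowSeries`. -/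
noncomputable def ratio (n k : ℕ) : ℝ :=
  -- The value 0 is the right one: `rowSeries` has no constant term, so its power k + 1 starts at
  -- degree k + 1 or later.
  if k + 1 ≤ n then ballot k (n - (k + 1)) / ballot 0 (n - 1) else 0

theorem coeff_rowSeries_pow_eq_ratio_mul {n : ℕ} (hn : 1 ≤ n) (k : ℕ) :
    PowerSeries.coeff n (rowSeries ^ (k + 1)) = ratio n k * (ballot 0 (n - 1) : ℂ) := by
  unfold ratio
  split_ifs with h
  · obtain ⟨m, rfl⟩ := Nat.exists_eq_add_of_le h
    have : (ballot 0 (k + 1 + m - 1) : ℂ) ≠ 0 := by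
      exact_mod_cast (ballot_pos 0 (k + 1 + m - 1)).ne'
    rw [coeff_rowSeries_pow, Nat.add_sub_cancel_left]
    push_cast
    field_simp
  · rw [coeff_rowSeries_pow_eq_zero (by omega)]
    simp

theorem ratio_nonneg (n k : ℕ) : 0 ≤ ratio n k := by
  unfold ratio
  split_ifs
  · exact (div_pos (ballot_pos _ _) (ballot_pos _ _)).le
  · exact le_rfl

theorem ratio_add_succ (k m : ℕ) : ratio (k + 2 + m) (k + 1) =
    ((k + 2) * (m + 1) / ((k + 1) * (2 * m + k + 2))) * ratio (k + 2 + m) k := by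
  unfold ratio
  rw [if_pos (by omega), if_pos (by omega), show k + 2 + m - (k + 1 + 1) = m by omega,
    show k + 2 + m - (k + 1) = m + 1 by omega, ballot_succ, mul_div_assoc]

/-- Each factor in `ratio_add_succ` is at most (k + 2)/(k + 1) · 1/2, and these bounds telescope.
They are also the limits of the factors, so the bound is the limit in `tendsto_ratio`. -/
theorem ratio_le (n k : ℕ) : ratio n k ≤ (k + 1) * (1 / 2) ^ k := by
  induction k with
  | zero =>
    unfold ratio
    split_ifs
    · simp [div_self (ballot_pos 0 (n - 1)).ne']
    · simp
  | succ k ih =>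
    by_cases h : k + 2 ≤ n
    · obtain ⟨m, rfl⟩ := Nat.exists_eq_add_of_le h
      rw [ratio_add_succ]
      have hle : ((k + 2) * (m + 1) / ((k + 1) * (2 * m + k + 2)) : ℝ) ≤
          (k + 2) / (k + 1) * (1 / 2) := by
        rw [div_mul_div_comm, div_le_div_iff₀ (by positivity) (by positivity)]
        have : (0 : ℝ) ≤ (k + 2) * (k + 1) * k := by positivity
        nlinarith
      refine (mul_le_mul hle ih (ratio_nonneg _ _) (by positivity)).trans_eq ?_
      push_cast
      field_simp
      ring
    · rw [ratio, if_neg (by omega)]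
      positivity

theorem tendsto_ratio (k : ℕ) :
    Tendsto (fun n => ratio n k) atTop (nhds ((k + 1) * (1 / 2) ^ k)) := by
  induction k with
  | zero =>
    refine tendsto_const_nhds.congr' ?_
    filter_upwards [eventually_ge_atTop 1] with n hn
    rw [ratio, if_pos (by omega)]
    simp [div_self (ballot_pos 0 (n - 1)).ne']
  | succ k ih =>
    rw [← tendsto_add_atTop_iff_nat (k + 2)] at ih ⊢
    have hlim : Tendsto (fun m : ℕ => ((k + 2) * (m + 1) / ((k + 1) * (2 * m + k + 2)) : ℝ)) atTop
        (nhds ((k + 2) / (k + 1) * (1 / 2))) := by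
      have h := tendsto_add_mul_div_add_mul_atTop_nhds (1 : ℝ) (k + 2) 1 (two_ne_zero)
      refine (h.const_mul ((k + 2) / (k + 1) : ℝ)).congr fun m => ?_
      rw [div_mul_div_comm]
      congr 1 <;> ring
    have h := (hlim.mul ih).congr (f₂ := fun m => ratio (m + (k + 2)) (k + 1)) fun m => by
      rw [add_comm m, ratio_add_succ]
    have e : ((k + 2) / (k + 1) * (1 / 2) * ((k + 1) * (1 / 2) ^ k) : ℝ) =
        ((k + 1 : ℕ) + 1) * (1 / 2) ^ (k + 1) := by
      push_cast
      field_simp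
      ring
    rwa [e] at h

/-! ### The analytic square root near 0 and 1/2 -/

/-- The branch of `√(1 + 2 u + 2 u ^ 2)` which is `1` at `0`. -/
noncomputable def sqrtQuad (u : ℂ) : ℂ := (1 + 2 * u + 2 * u ^ 2) ^ ((2 : ℂ)⁻¹)

/-- The roots (-1 ± i)/2 have modulus 1/√2 > 7/10 > 1/2. The imaginary part 2 · Im u · (1 + 2 Re u)
vanishes only for real u or Re u = -1/2, and there the real part is positive. -/
theorem quad_mem_slitPlane {u : ℂ} (hu : ‖u‖ < 7 / 10) :
    1 + 2 * u + 2 * u ^ 2 ∈ Complex.slitPlane := by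
  have hn : u.re ^ 2 + u.im ^ 2 < 49 / 100 := by
    have h := Complex.sq_norm u
    rw [Complex.normSq_apply] at h
    nlinarith [norm_nonneg u]
  rw [Complex.mem_slitPlane_iff]
  simp only [pow_two, Complex.add_re, Complex.add_im, Complex.mul_re, Complex.mul_im,
    Complex.one_re, Complex.one_im, Complex.re_ofNat, Complex.im_ofNat]
  by_cases h : u.im = 0
  · left
    rw [h]
    nlinarith [sq_nonneg (2 * u.re + 1)]
  · by_cases h' : 1 + 2 * u.re = 0
    · left
      have : u.re = -1 / 2 := by linarith
      rw [this] at hn ⊢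
      nlinarith
    · right
      have := mul_ne_zero h h'
      contrapose! this
      linarith

theorem sqrtQuad_sq (u : ℂ) : sqrtQuad u ^ 2 = 1 + 2 * u + 2 * u ^ 2 := by
  exact Complex.cpow_nat_inv_pow (1 + 2 * u + 2 * u ^ 2) two_ne_zero

theorem sqrtQuad_zero : sqrtQuad 0 = 1 := by simp [sqrtQuad]

theorem sqrtQuad_half : sqrtQuad (1 / 2) = (Real.sqrt 10 / 2 : ℝ) := by
  have h : (1 + 2 * (1 / 2) + 2 * (1 / 2) ^ 2 : ℂ) = ((5 / 2 : ℝ) : ℂ) := by push_cast; norm_num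
  have h' : ((2 : ℂ)⁻¹) = ((1 / 2 : ℝ) : ℂ) := by push_cast; norm_num
  rw [sqrtQuad, h, h', ← Complex.ofReal_cpow (by norm_num), ← Real.sqrt_eq_rpow]
  congr 1
  rw [show (5 / 2 : ℝ) = 10 / 2 ^ 2 by norm_num, Real.sqrt_div (by norm_num),
    Real.sqrt_sq (by norm_num)]

theorem differentiableAt_sqrtQuad {u : ℂ} (hu : ‖u‖ < 7 / 10) :
    DifferentiableAt ℂ sqrtQuad u := by
  unfold sqrtQuad
  exact DifferentiableAt.cpow_const (by fun_prop) (quad_mem_slitPlane hu)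

theorem differentiableOn_sqrtQuad : DifferentiableOn ℂ sqrtQuad (Metric.ball 0 (7 / 10)) :=
  fun u hu => (differentiableAt_sqrtQuad (by simpa using hu)).differentiableWithinAt

theorem hasDerivAt_quad (u : ℂ) :
    HasDerivAt (fun u : ℂ => 1 + 2 * u + 2 * u ^ 2) (2 + 4 * u) u := by
  have h : HasDerivAt (fun u : ℂ => 1 + 2 * u + 2 * u ^ 2) _ u :=
    (((hasDerivAt_id u).const_mul 2).const_add 1).add (((hasDerivAt_id u).pow 2).const_mul 2)
  refine h.congr_deriv ?_
  simp only [id_eq, Nat.cast_ofNat]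
  ring

/-- Differentiating f² = 1 + 2u + 2u² gives 2 f f' = 2 + 4u, which is 4 at u = 1/2. -/
theorem deriv_sqrtQuad_half : deriv sqrtQuad (1 / 2) = (4 / Real.sqrt 10 : ℝ) := by
  have hd := (differentiableAt_sqrtQuad (u := 1 / 2) (by norm_num)).hasDerivAt
  have h₁ := hd.pow 2
  have e : sqrtQuad ^ 2 = fun u => 1 + 2 * u + 2 * u ^ 2 := funext fun u => sqrtQuad_sq u
  have h₂ := hasDerivAt_quad (1 / 2)
  rw [← e] at h₂
  have h := h₁.unique h₂
  have hs : (Real.sqrt 10 : ℂ) ≠ 0 := by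
    exact_mod_cast (Real.sqrt_pos.mpr (by norm_num : (0 : ℝ) < 10)).ne'
  rw [sqrtQuad_half] at h
  push_cast at h ⊢
  rw [eq_div_iff hs]
  linear_combination h

/-! ### Taylor series and substitution of `rowSeries` -/

/-- The Taylor series at `0` of a function. -/
noncomputable def taylorPowerSeries (f : ℂ → ℂ) : PowerSeries ℂ :=
  PowerSeries.mk fun k => iteratedDeriv k f 0 / k !

theorem taylorPowerSeries_mul {f g : ℂ → ℂ} (hf : AnalyticAt ℂ f 0) (hg : AnalyticAt ℂ g 0) :
    taylorPowerSeries (f * g) = taylorPowerSeries f * taylorPowerSeries g := by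
  ext n
  rw [PowerSeries.coeff_mul, Finset.Nat.sum_antidiagonal_eq_sum_range_succ_mk]
  simp only [taylorPowerSeries, PowerSeries.coeff_mk]
  rw [iteratedDeriv_mul hf.contDiffAt hg.contDiffAt, Finset.sum_div]
  refine Finset.sum_congr rfl fun i hi => ?_
  have hi' : i ≤ n := Nat.lt_succ_iff.mp (Finset.mem_range.mp hi)
  rw [Nat.cast_choose ℂ hi']
  have h₁ : (n ! : ℂ) ≠ 0 := by exact_mod_cast n.factorial_ne_zero
  field_simp

theorem taylorPowerSeries_quad :
    taylorPowerSeries (fun u => 1 + 2 * u + 2 * u ^ 2) =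
      1 + 2 * PowerSeries.X + 2 * PowerSeries.X ^ 2 := by
  have d₁ : deriv (fun u : ℂ => 1 + 2 * u + 2 * u ^ 2) = fun u => 2 + 4 * u :=
    funext fun u => (hasDerivAt_quad u).deriv
  have d₂ : deriv (fun u : ℂ => 2 + 4 * u) = fun _ => 4 := by
    ext u
    have h : HasDerivAt (fun u : ℂ => 2 + 4 * u) (4 * 1) u :=
      ((hasDerivAt_id u).const_mul 4).const_add 2
    rw [h.deriv, mul_one]
  rw [show (2 : PowerSeries ℂ) = PowerSeries.C 2 from rfl]
  ext n
  simp only [taylorPowerSeries, PowerSeries.coeff_mk, map_add, PowerSeries.coeff_C_mul,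
    PowerSeries.coeff_X, PowerSeries.coeff_one, PowerSeries.coeff_X_pow]
  match n with
  | 0 => simp
  | 1 => simp [iteratedDeriv_succ', d₁]
  | 2 => simp [iteratedDeriv_succ', d₁, d₂]; norm_num
  | n + 3 => simp [iteratedDeriv_succ', d₁, d₂, iteratedDeriv_const]

theorem taylorPowerSeries_sqrtQuad_sq :
    taylorPowerSeries sqrtQuad ^ 2 = 1 + 2 * PowerSeries.X + 2 * PowerSeries.X ^ 2 := by
  have ha : AnalyticAt ℂ sqrtQuad 0 :=
    differentiableOn_sqrtQuad.analyticAt (Metric.ball_mem_nhds _ (by norm_num))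
  rw [pow_two, ← taylorPowerSeries_mul ha ha, ← taylorPowerSeries_quad]
  congr 1
  ext u
  rw [Pi.mul_apply, ← pow_two, sqrtQuad_sq]

theorem constantCoeff_taylorPowerSeries_sqrtQuad :
    PowerSeries.constantCoeff (taylorPowerSeries sqrtQuad) = 1 := by
  rw [← PowerSeries.coeff_zero_eq_constantCoeff_apply]
  simp [taylorPowerSeries, sqrtQuad_zero]

theorem hasSum_deriv_of_taylorPowerSeries {f : ℂ → ℂ} {r : ℝ}
    (hf : DifferentiableOn ℂ f (Metric.ball 0 r)) {z : ℂ} (hz : z ∈ Metric.ball 0 r) :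
    HasSum (fun k : ℕ => PowerSeries.coeff (k + 1) (taylorPowerSeries f) * ((k + 1) * z ^ k))
      (deriv f z) := by
  have e : (fun k : ℕ => PowerSeries.coeff (k + 1) (taylorPowerSeries f) * ((k + 1) * z ^ k)) =
      fun k : ℕ => (k ! : ℂ)⁻¹ • (z - 0) ^ k • iteratedDeriv k (deriv f) 0 := by
    ext k
    rw [taylorPowerSeries]
    rw [PowerSeries.coeff_mk, iteratedDeriv_succ', Nat.factorial_succ]
    have h₁ : (k ! : ℂ) ≠ 0 := by exact_mod_cast k.factorial_ne_zero
    have h₂ : (k + 1 : ℂ) ≠ 0 := by exact_mod_cast k.succ_ne_zero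
    simp only [sub_zero, smul_eq_mul]
    push_cast
    field_simp
  rw [e]
  exact Complex.hasSum_taylorSeries_on_ball (hf.deriv Metric.isOpen_ball) hz

theorem subst_taylorPowerSeries_sqrtQuad :
    (taylorPowerSeries sqrtQuad).subst rowSeries = 1 + 2 * rowSeries - 2 * falseSeries := by
  have hs : PowerSeries.HasSubst rowSeries :=
    PowerSeries.HasSubst.of_constantCoeff_zero' constantCoeff_rowSeries
  have h := congrArg (PowerSeries.substAlgHom (R := ℂ) hs) taylorPowerSeries_sqrtQuad_sq
  simp only [map_add, map_mul, map_pow, map_one, map_ofNat, PowerSeries.substAlgHom_X] at h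
  rw [PowerSeries.coe_substAlgHom] at h
  have hsq := h.trans sq_one_add_two_mul_rowSeries_sub.symm
  -- Two square roots of one series agree up to sign; the constant term 1 on both sides excludes the
  -- minus sign.
  rcases sq_eq_sq_iff_eq_or_eq_neg.mp hsq with h | h
  · exact h
  · exfalso
    have hc : PowerSeries.constantCoeff ((taylorPowerSeries sqrtQuad).subst rowSeries) = 1 := by
      rw [← PowerSeries.coeff_zero_eq_constantCoeff_apply, PowerSeries.coeff_subst' hs,
        finsum_eq_single _ 0]
      · simp [constantCoeff_taylorPowerSeries_sqrtQuad]
      · intro k hk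
        rw [coeff_rowSeries_pow_eq_zero (Nat.pos_of_ne_zero hk), smul_zero]
    have h' := congrArg PowerSeries.constantCoeff h
    rw [hc] at h'
    simp [constantCoeff_rowSeries, constantCoeff_falseSeries] at h'
    norm_num at h'

theorem coeff_subst_rowSeries (f : PowerSeries ℂ) {n : ℕ} (hn : 1 ≤ n) :
    PowerSeries.coeff n (f.subst rowSeries) =
      (∑' k : ℕ, PowerSeries.coeff (k + 1) f * ratio n k) * (ballot 0 (n - 1) : ℂ) := by
  have hs : PowerSeries.HasSubst rowSeries :=
    PowerSeries.HasSubst.of_constantCoeff_zero' constantCoeff_rowSeries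
  have h₁ : ∀ k ∉ Finset.range (n + 1),
      PowerSeries.coeff k f • PowerSeries.coeff n (rowSeries ^ k) = 0 := by
    intro k hk
    rw [Finset.mem_range] at hk
    rw [coeff_rowSeries_pow_eq_zero (by omega), smul_zero]
  have h₂ : ∀ k ∉ Finset.range n, PowerSeries.coeff (k + 1) f * (ratio n k : ℂ) = 0 := by
    intro k hk
    rw [Finset.mem_range] at hk
    rw [ratio, if_neg (by omega), Complex.ofReal_zero, mul_zero]
  rw [PowerSeries.coeff_subst' hs, finsum_eq_sum_of_support_subset (s := Finset.range (n + 1)),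
    tsum_eq_sum h₂, Finset.sum_range_succ', Finset.sum_mul, pow_zero, PowerSeries.coeff_one,
    if_neg (by omega), smul_zero, add_zero]
  · refine Finset.sum_congr rfl fun k _ => ?_
    rw [coeff_rowSeries_pow_eq_ratio_mul hn, smul_eq_mul, mul_assoc]
  · intro k hk
    by_contra h
    exact hk (h₁ k h)

/-- Transfer of the coefficients of `MFormula.rowSeries` through an analytic function. -/
theorem tendsto_coeff_subst_rowSeries {f : ℂ → ℂ} {r : ℝ} (hr : 1 / 2 < r)
    (hf : DifferentiableOn ℂ f (Metric.ball 0 r)) :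
    Tendsto (fun n => PowerSeries.coeff n ((taylorPowerSeries f).subst rowSeries) /
      (ballot 0 (n - 1) : ℂ)) atTop (nhds (deriv f (1 / 2))) := by
  have hsum := hasSum_deriv_of_taylorPowerSeries hf (z := 1 / 2) (by simpa using hr)
  have hlim : Tendsto
      (fun n => ∑' k : ℕ, PowerSeries.coeff (k + 1) (taylorPowerSeries f) * (ratio n k : ℂ))
      atTop (nhds (deriv f (1 / 2))) := by
    rw [← hsum.tsum_eq]
    -- The dominating series is the absolutely convergent Taylor series of f' at 1/2, by `ratio_le`.
    refine tendsto_tsum_of_dominated_convergence hsum.summable.norm ?_ ?_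
    · intro k
      have h := (Complex.continuous_ofReal.tendsto _).comp (tendsto_ratio k)
      push_cast at h
      exact h.const_mul _
    · refine Eventually.of_forall fun n k => ?_
      have e : ((k + 1) * (1 / 2) ^ k : ℂ) = (((k + 1) * (1 / 2) ^ k : ℝ) : ℂ) := by push_cast; rfl
      rw [e, norm_mul, norm_mul, Complex.norm_real, Complex.norm_real,
        Real.norm_of_nonneg (ratio_nonneg n k), Real.norm_of_nonneg (by positivity)]
      exact mul_le_mul_of_nonneg_left (ratio_le n k) (norm_nonneg _)
  refine hlim.congr' ?_
  filter_upwards [eventually_ge_atTop 1] with n hn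
  have : (ballot 0 (n - 1) : ℂ) ≠ 0 := by exact_mod_cast (ballot_pos 0 (n - 1)).ne'
  rw [coeff_subst_rowSeries _ hn, mul_div_cancel_right₀ _ this]

/-! ### The limiting proportion of false rows -/

theorem tendsto_totalFalseRows_div :
    Tendsto (fun n => (totalFalseRows n : ℝ) / ballot 0 (n - 1)) atTop
      (nhds ((10 - 2 * Real.sqrt 10) / 10)) := by
  have h := tendsto_coeff_subst_rowSeries (by norm_num) differentiableOn_sqrtQuad
  rw [subst_taylorPowerSeries_sqrtQuad, deriv_sqrtQuad_half] at h
  have h' := (h.const_mul (1 / 2)).const_sub 1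
  rw [← tendsto_ofReal_iff]
  have e : ((1 : ℂ) - 1 / 2 * ((4 / Real.sqrt 10 : ℝ) : ℂ)) =
      (((10 - 2 * Real.sqrt 10) / 10 : ℝ) : ℂ) := by
    rw [← Complex.ofReal_one, ← Complex.ofReal_ofNat, ← Complex.ofReal_div, ← Complex.ofReal_mul,
      ← Complex.ofReal_sub]
    congr 1
    have hs : Real.sqrt 10 ^ 2 = 10 := Real.sq_sqrt (by norm_num)
    have hs' : Real.sqrt 10 ≠ 0 := (Real.sqrt_pos.mpr (by norm_num : (0 : ℝ) < 10)).ne'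
    field_simp
    linear_combination 4 * hs
  rw [e] at h'
  refine h'.congr' ?_
  filter_upwards [eventually_ge_atTop 1] with n hn
  obtain ⟨m, rfl⟩ := Nat.exists_eq_add_of_le' hn
  have hb : (ballot 0 m : ℂ) ≠ 0 := by exact_mod_cast (ballot_pos 0 m).ne'
  have hg : PowerSeries.coeff (m + 1) rowSeries = (ballot 0 m : ℂ) := by
    rw [coeff_succ_rowSeries, ballot_zero]
    push_cast
    rfl
  rw [show (2 : PowerSeries ℂ) = PowerSeries.C 2 from rfl]
  simp only [map_sub, map_add, PowerSeries.coeff_C_mul, coeff_succ_falseSeries, hg,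
    PowerSeries.coeff_one, Nat.succ_ne_zero, if_false, Nat.add_sub_cancel]
  push_cast
  field_simp
  ring

/-! ### Asymptotics of the total row count by Wallis' product -/

open Real.Wallis in
theorem centralBinom_sq_mul_W (m : ℕ) :
    (Nat.centralBinom m : ℝ) ^ 2 * (2 * m + 1) * W m = (2 ^ (2 * m)) ^ 2 := by
  have h' := centralBinom_mul_factorial_mul_factorial m
  have hm : (m ! : ℝ) ≠ 0 := by exact_mod_cast m.factorial_ne_zero
  have hc : (Nat.centralBinom m : ℝ) ≠ 0 := by exact_mod_cast m.centralBinom_ne_zero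
  rw [W_eq_factorial_ratio, ← h']
  field_simp
  ring

open Real.Wallis in
theorem tendsto_ballot_zero_div :
    Tendsto (fun n : ℕ => ballot 0 (n - 1) /
      ((2 : ℝ) ^ (3 * (n : ℤ) - 2) / Real.sqrt (Real.pi * (n : ℝ) ^ 3))) atTop (nhds 1) := by
  rw [← tendsto_add_atTop_iff_nat 1]
  -- By `centralBinom_sq_mul_W` the square of the quotient is rational in m apart from π / `W m`; as
  -- `W m` → π/2, it tends to 2 · 1/2 = 1.
  have key : ∀ m : ℕ, Real.sqrt ((Real.pi / W m) * (((1 : ℝ) + 1 * m) / (1 + 2 * m))) =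
      ballot 0 (m + 1 - 1) / ((2 : ℝ) ^ (3 * ((m + 1 : ℕ) : ℤ) - 2) /
        Real.sqrt (Real.pi * ((m + 1 : ℕ) : ℝ) ^ 3)) := by
    intro m
    have hW := W_pos m
    have hpi := Real.pi_pos
    have hz : (2 : ℝ) ^ (3 * ((m + 1 : ℕ) : ℤ) - 2) = 2 ^ (m + 1) * 2 ^ (2 * m) := by
      rw [← pow_add, ← zpow_natCast]
      congr 1
      push_cast
      ring
    have hcat : ((m : ℝ) + 1) * catalan m = Nat.centralBinom m := by
      exact_mod_cast succ_mul_catalan_eq_centralBinom m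
    have hsq := centralBinom_sq_mul_W m
    rw [← hcat] at hsq
    rw [Nat.add_sub_cancel, ballot_zero, hz, div_div_eq_mul_div]
    have e : Real.pi / W m * (((1 : ℝ) + 1 * m) / (1 + 2 * m)) =
        (catalan m / 2 ^ (2 * m)) ^ 2 * (Real.pi * ((m + 1 : ℕ) : ℝ) ^ 3) := by
      rw [div_pow, ← hsq]
      have hc : (catalan m : ℝ) ≠ 0 := by
        intro h0
        have := m.centralBinom_pos
        rw [h0, mul_zero] at hcat
        exact this.ne' (by exact_mod_cast hcat.symm)
      push_cast
      have : (1 + 2 * m : ℝ) ≠ 0 := by positivity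
      field_simp
      ring
    rw [e, Real.sqrt_mul (by positivity), Real.sqrt_sq (by positivity)]
    field_simp
  refine Tendsto.congr key ?_
  have h₁ : Tendsto (fun m => Real.pi / W m) atTop (nhds (Real.pi / (Real.pi / 2))) :=
    tendsto_const_nhds.div tendsto_W_nhds_pi_div_two (by positivity)
  have h₂ := tendsto_add_mul_div_add_mul_atTop_nhds (1 : ℝ) 1 1 two_ne_zero
  have h := (h₁.mul h₂).sqrt
  have e : Real.pi / (Real.pi / 2) * (1 / 2) = 1 := by field_simp
  rwa [e, Real.sqrt_one] at h

end MFormula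

theorem theorem3p3 :
    (fun n : ℕ => (MFormula.totalFalseRows n : ℝ)) ~[atTop]
      fun n : ℕ => ((10 - 2 * Real.sqrt 10) / 10) *
        ((2 : ℝ) ^ (3 * (n : ℤ) - 2) / Real.sqrt (Real.pi * (n : ℝ) ^ 3)) := by
  have hc : 0 < (10 - 2 * Real.sqrt 10) / 10 := by
    have : Real.sqrt 10 < 5 := by rw [Real.sqrt_lt' (by norm_num)]; norm_num
    linarith
  apply isEquivalent_of_tendsto_one
  have h := (MFormula.tendsto_totalFalseRows_div.mul
    MFormula.tendsto_ballot_zero_div).div_const ((10 - 2 * Real.sqrt 10) / 10)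
  rw [mul_one, div_self hc.ne'] at h
  refine h.congr fun n => ?_
  have hb := (MFormula.ballot_pos 0 (n - 1)).ne'
  rw [div_mul_div_cancel₀ hb, div_div, Pi.div_apply, mul_comm]
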